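/- Let $2^\omega$ be Cantor space (its points are called reals), $2^{<\omega}$ the set of finite binary strings, $X\upharpoonright n$ the initial segment of $X$ of length $n$, and $[W]^\preceq$ the set of reals that extend some string of $W\subseteq 2^{<\omega}$. A $\Pi^0_1$ class is a set $\{X\in 2^\omega:\forall n\; X\upharpoonright n\in T\}$ with $T\subseteq 2^{<\omega}$ a computable tree (a set closed under prefixes); a $\Sigma^0_2$ class is a set $\{X\in 2^\omega:\exists m\,\forall n\; (X\upharpoonright n,m)\in R\}$ with $R\subseteq 2^{<\omega}\times\omega$ computable. A set $S\subseteq 2^\omega\times\omega$ is $\Pi^0_1$ (respectively $\Sigma^0_2$) if there is a computable relation $R$ such that $(X,e)\in S\Leftrightarrow \forall n\; (X\upharpoonright n,e)\in R$ (respectively $(X,e)\in S\Leftrightarrow\exists m\,\forall n\; (X\upharpoonright n,m,e)\in R$). A family $\mathcal C$ of $\Pi^0_1$ (respectively $\Sigma^0_2$) classes is effectively enumerable if there is a $\Pi^0_1$ (respectively $\Sigma^0_2$) set $S\subseteq 2^\omega\times\omega$ with $\mathcal C=\{\{X:(X,e)\in S\}:e\in\omega\}$. Let $\mu$ be the fair-coin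 measure on $2^\omega$. A real is Martin-Löf random if it does not belong to $\bigcap_n [W_n]^\preceq$ for any uniformly c.e. sequence $(W_n)_{n\in\omega}$ of sets of strings with $\mu([W_n]^\preceq)\le 2^{-n}$ for all $n$. Let $K$ be prefix-free Kolmogorov complexity based on an arbitrary optimal (universal) prefix-free machine. For $c\in\omega$, a real $X$ is Martin-Löf random with randomness constant $c$ if $X$ is Martin-Löf random and $K(X\upharpoonright n)\ge n-c$ for all $n$. **Proposition.** 1. For each such choice of the machine underlying $K$ and each $c\in\omega$, the family of all $\Pi^0_1$ classes containing only reals that are Martin-Löf random with randomness constant $c$ is effectively enumerable. 2. The family of all $\Sigma^0_2$ classes containing only Martin-Löf random reals is effectively enumerable. -/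

import Mathlib

open MeasureTheory

namespace Numberings

/-- Cantor space; its points are called reals. -/
abbrev Cantor : Type := ℕ → Bool

/-- The initial segment of `X` of length `n`. -/
def initSeg (X : Cantor) (n : ℕ) : List Bool := (List.range n).map X

/-- The cone of all infinite binary sequences extending the string `σ`. -/
def cone (σ : List Bool) : Set Cantor := {X | initSeg X σ.length = σ}

/-- The union of the cones of the members of a set of strings. -/
def coneUnion (W : Set (List Bool)) : Set Cantor := ⋃ σ ∈ W, cone σ

/-- A set of strings is a tree if it is closed under prefixes. -/
def IsTree (T : Set (List Bool)) : Prop :=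
  ∀ σ τ : List Bool, σ ++ τ ∈ T → σ ∈ T

/-- The set of infinite paths through a set of strings. -/
def paths (T : Set (List Bool)) : Set Cantor := {X | ∀ n, initSeg X n ∈ T}

/-- Lightface `Π⁰₁` classes: the sets of paths through computable trees. -/
def IsPi01Class (P : Set Cantor) : Prop :=
  ∃ T : Set (List Bool), ComputablePred (fun σ => σ ∈ T) ∧ IsTree T ∧ P = paths T

/-- Lightface `Σ⁰₂` classes, in normal form over a computable relation. -/
def IsSigma02Class (P : Set Cantor) : Prop :=
  ∃ R : Set (List Bool × ℕ), ComputablePred (fun p => p ∈ R) ∧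
    P = {X | ∃ m, ∀ n, (initSeg X n, m) ∈ R}

/-- Lightface `Π⁰₁` subsets of the product of Cantor space with the natural numbers. -/
def IsPi01Set (S : Set (Cantor × ℕ)) : Prop :=
  ∃ R : Set (List Bool × ℕ), ComputablePred (fun p => p ∈ R) ∧
    S = {p | ∀ n, (initSeg p.1 n, p.2) ∈ R}

/-- Lightface `Σ⁰₂` subsets of the product of Cantor space with the natural numbers. -/
def IsSigma02Set (S : Set (Cantor × ℕ)) : Prop :=
  ∃ R : Set (List Bool × ℕ × ℕ), ComputablePred (fun p => p ∈ R) ∧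
    S = {p | ∃ m, ∀ n, (initSeg p.1 n, m, p.2) ∈ R}

/-- The family of all sections `{X | (X, e) ∈ S}`, for `e` a natural number. -/
def sections (S : Set (Cantor × ℕ)) : Set (Set Cantor) :=
  Set.range fun e : ℕ => {X | (X, e) ∈ S}

/-- Effective enumerability of a family of `Π⁰₁` classes. -/
def EffectivelyEnumerablePi01 (C : Set (Set Cantor)) : Prop :=
  ∃ S : Set (Cantor × ℕ), IsPi01Set S ∧ C = sections S

/-- Effective enumerability of a family of `Σ⁰₂` classes. -/
def EffectivelyEnumerableSigma02 (C : Set (Set Cantor)) : Prop :=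
  ∃ S : Set (Cantor × ℕ), IsSigma02Set S ∧ C = sections S

/-- The fair-coin measure on Cantor space. -/
noncomputable def coinMeasure : Measure Cantor :=
  Measure.infinitePi fun _ : ℕ => (PMF.uniformOfFintype Bool).toMeasure

/-- Martin-Löf tests: the `n`-th open set of the test is generated by the `n`-th row of a
computably enumerable set `W`, and has measure at most `2 ^ (-n)`. -/
def IsMartinLofTest (W : Set (ℕ × List Bool)) : Prop :=
  REPred (fun p => p ∈ W) ∧
    ∀ n : ℕ, coinMeasure (coneUnion {σ | (n, σ) ∈ W}) ≤ ((2 : ENNReal)⁻¹) ^ n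

/-- The set of all Martin-Löf random reals. -/
def MLR : Set Cantor :=
  {X | ∀ W : Set (ℕ × List Bool), IsMartinLofTest W →
    ∃ n, X ∉ coneUnion {σ | (n, σ) ∈ W}}

/-- Prefix-free machines: partial computable functions on strings with prefix-free domain. -/
def IsPrefixMachine (M : List Bool →. List Bool) : Prop :=
  Partrec M ∧ ∀ σ τ : List Bool, (M σ).Dom → (M τ).Dom → σ <+: τ → σ = τ

/-- Optimal (universal) prefix-free machines: they simulate every prefix-free machine up to
an additive constant in the length of descriptions. -/
def IsOptimalPrefixMachine (U : List Bool →. List Bool) : Prop :=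
  IsPrefixMachine U ∧ ∀ M : List Bool →. List Bool, IsPrefixMachine M →
    ∃ d : ℕ, ∀ σ τ : List Bool, τ ∈ M σ → ∃ ρ, τ ∈ U ρ ∧ ρ.length ≤ σ.length + d

/-- Prefix-free Kolmogorov complexity of `τ` relative to the machine `U`: the least length of
a description of `τ`. -/
noncomputable def K (U : List Bool →. List Bool) (τ : List Bool) : ℕ∞ :=
  ⨅ (σ : List Bool) (_ : τ ∈ U σ), (σ.length : ℕ∞)

/-- The reals that are Martin-Löf random with randomness constant `c`, that is, the Martin-Löf
random reals whose initial segments satisfy `K (X ↾ n) ≥ n - c` for all `n`. -/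
def randomWithConstant (U : List Bool →. List Bool) (c : ℕ) : Set Cantor :=
  {X | X ∈ MLR ∧ ∀ n : ℕ, (n : ℕ∞) ≤ K U (initSeg X n) + c}

end Numberings

/-! Both parts use one device. Index all classes of the given kind by codes `e` for the c.e. set of
forbidden strings (or string-witness pairs), and intersect the `e`-th class with one fixed class of
randoms of the same complexity. A class inside the fixed class is unchanged, and every other class
is cut down to a member of the family, so the sections are exactly the family.

For part 1 the fixed class is "no initial segment is compressible by more than `c`", which is Π⁰₁
because descriptions can be searched for. It equals `randomWithConstant U c` by the half of
Schnorr's theorem in `mem_MLR_of_le_K`, which rests on a Kraft–Chaitin machine. For part 2 it is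
`MLR`, which is Σ⁰₂ because a single universal test suffices (`mem_MLR_iff_universalTest`).

In both parts the forbidden strings are only c.e., while the definitions ask for a computable
relation; `exists_prefixClosed_computable` bridges this gap. -/

namespace Numberings

open Encodable Nat.Partrec
open scoped ENNReal

/-! ### Stage-bounded computations and c.e. predicates. -/

section RecursivelyEnumerable

variable {α β : Type*} [Primcodable α] [Primcodable β]

/-- The computation of the code `c` on the (encoded) input `a` halts within `s` stages. -/
def HaltsBy (c : Code) (s : ℕ) (a : α) : Prop := (Code.evaln s c (encode a)).isSome = true

instance (c : Code) (s : ℕ) (a : α) : Decidable (HaltsBy c s a) :=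
  inferInstanceAs (Decidable (_ = _))

theorem HaltsBy.mono {c : Code} {s t : ℕ} {a : α} (h : HaltsBy c s a) (hst : s ≤ t) :
    HaltsBy c t a := by
  obtain ⟨x, hx⟩ := Option.isSome_iff_exists.1 h
  exact Option.isSome_iff_exists.2 ⟨x, Code.evaln_mono hst hx⟩

theorem primrecPred_haltsBy : PrimrecPred fun p : (ℕ × Code) × α => HaltsBy p.1.2 p.1.1 p.2 :=
  Primrec.eq.comp (Primrec.option_isSome.comp (Code.primrec_evaln.comp
    (Primrec.pair Primrec.fst (Primrec.encode.comp Primrec.snd)))) (Primrec.const true)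

theorem PrimrecPred.haltsBy {f : β → ℕ} {g : β → Code} {h : β → α} (hf : Primrec f)
    (hg : Primrec g) (hh : Primrec h) : PrimrecPred fun b => HaltsBy (g b) (f b) (h b) :=
  primrecPred_haltsBy.comp (Primrec.pair (Primrec.pair hf hg) hh)

theorem exists_code_of_partrec {f : α →. β} (hf : Partrec f) :
    ∃ c : Code, ∀ a, Code.eval c (encode a) = (f a).map encode := by
  obtain ⟨c, hc⟩ := Code.exists_code.1 hf
  exact ⟨c, fun a => by rw [hc]; simp⟩

theorem exists_haltsBy_iff {c : Code} {a : α} :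
    (∃ s, HaltsBy c s a) ↔ (Code.eval c (encode a)).Dom := by
  simp only [HaltsBy, Option.isSome_iff_exists, Part.dom_iff_mem, Code.evaln_complete,
    Option.mem_def]
  exact exists_comm

theorem exists_code_of_rePred {p : α → Prop} (hp : REPred p) :
    ∃ c : Code, ∀ a, p a ↔ ∃ s, HaltsBy c s a := by
  obtain ⟨c, hc⟩ := exists_code_of_partrec hp
  refine ⟨c, fun a => ?_⟩
  rw [exists_haltsBy_iff, hc]
  simp [Part.assert]

theorem primrecPred_forall_lt {f : α → ℕ} {q : ℕ → α → Prop} (hf : Primrec f)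
    (hq : PrimrecRel q) : PrimrecPred fun a => ∀ i < f a, q i a :=
  (hq.forall_mem_list.comp (Primrec.list_range.comp hf) Primrec.id).of_eq fun a => by simp

theorem primrecPred_exists_lt {f : α → ℕ} {q : ℕ → α → Prop} (hf : Primrec f)
    (hq : PrimrecRel q) : PrimrecPred fun a => ∃ i < f a, q i a :=
  (hq.exists_mem_list.comp (Primrec.list_range.comp hf) Primrec.id).of_eq fun a => by simp

theorem rePred_exists {q : α → β → Prop} (hq : PrimrecPred fun p : α × β => q p.1 p.2) :
    REPred fun a => ∃ b, q a b := by
  classical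
  obtain ⟨_, hq⟩ := hq
  have hf : Primrec₂ fun (a : α) (k : ℕ) =>
      (decode k : Option β).bind fun b => if q a b then some () else none := by
    refine Primrec.option_bind (Primrec.decode.comp Primrec.snd)
      (Primrec.ite ?_ (Primrec.const _) (Primrec.const _))
    exact PrimrecPred.comp (p := fun p : α × β => q p.1 p.2) ⟨_, hq⟩
      (Primrec.pair (Primrec.fst.comp Primrec.fst) Primrec.snd)
  refine (Partrec.rfindOpt hf.to_comp).dom_re.of_eq fun a => Nat.rfindOpt_dom.trans ?_
  simp only [Option.mem_def, Option.bind_eq_some_iff, Option.ite_none_right_eq_some]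
  constructor
  · rintro ⟨_, _, b, _, hb, _⟩
    exact ⟨b, hb⟩
  · rintro ⟨b, hb⟩
    exact ⟨encode b, (), b, encodek b, hb, trivial⟩

theorem rePred_or {p q : α → Prop} (hp : REPred p) (hq : REPred q) :
    REPred fun a => p a ∨ q a := by
  obtain ⟨c, hc⟩ := exists_code_of_rePred hp
  obtain ⟨d, hd⟩ := exists_code_of_rePred hq
  refine (rePred_exists (q := fun a s => HaltsBy c s a ∨ HaltsBy d s a) ?_).of_eq fun a => ?_
  · exact (PrimrecPred.haltsBy Primrec.snd (Primrec.const c) Primrec.fst).or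
      (PrimrecPred.haltsBy Primrec.snd (Primrec.const d) Primrec.fst)
  · rw [exists_or, hc, hd]

theorem rePred_comp {p : β → Prop} (hp : REPred p) {f : α → β} (hf : Computable f) :
    REPred fun a => p (f a) :=
  Partrec.comp (f := fun b => Part.assert (p b) fun _ => Part.some ()) hp hf

theorem computablePred_comp {p : β → Prop} (hp : ComputablePred p) {f : α → β}
    (hf : Computable f) : ComputablePred fun a => p (f a) := by
  obtain ⟨g, hg, rfl⟩ := ComputablePred.computable_iff.1 hp
  exact ComputablePred.computable_iff.2 ⟨fun a => g (f a), hg.comp hf, rfl⟩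

theorem rePred_halts {g : α → Code} {h : α → β} (hg : Primrec g) (hh : Primrec h) :
    REPred fun a => ∃ s, HaltsBy (g a) s (h a) :=
  rePred_exists (PrimrecPred.haltsBy Primrec.snd (hg.comp Primrec.fst) (hh.comp Primrec.fst))

end RecursivelyEnumerable

/-! ### Initial segments, and computable trees from c.e. sets of forbidden strings. -/

section Strings

@[simp] theorem length_initSeg (X : Cantor) (n : ℕ) : (initSeg X n).length = n := by
  simp [initSeg]

theorem take_initSeg (X : Cantor) (i n : ℕ) : (initSeg X n).take i = initSeg X (min i n) := by
  simp [initSeg, ← List.map_take, List.take_range]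

theorem mem_cone_iff {X : Cantor} {σ : List Bool} : X ∈ cone σ ↔ initSeg X σ.length = σ := Iff.rfl

theorem mem_coneUnion_iff {X : Cantor} {W : Set (List Bool)} :
    X ∈ coneUnion W ↔ ∃ n, initSeg X n ∈ W := by
  simp only [coneUnion, Set.mem_iUnion, exists_prop, mem_cone_iff]
  constructor
  · rintro ⟨σ, hσ, h⟩
    exact ⟨σ.length, by rwa [h]⟩
  · rintro ⟨n, h⟩
    exact ⟨_, h, by simp⟩

variable {α : Type*} [Primcodable α]

/-- Reject a string of length `s` once `s` stages of enumerating `A` have produced one of its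
prefixes. This is decidable and persists under extension, and the delay is harmless: along a real,
every forbidden initial segment is noticed at some later length. -/
theorem exists_prefixClosed_computable {A : List Bool × α → Prop} (hA : REPred A) :
    ∃ R : Set (List Bool × α), ComputablePred (fun p => p ∈ R) ∧
      (∀ σ τ a, (σ ++ τ, a) ∈ R → (σ, a) ∈ R) ∧
      ∀ X a, (∀ n, (initSeg X n, a) ∈ R) ↔ ∀ n, ¬ A (initSeg X n, a) := by
  obtain ⟨c, hc⟩ := exists_code_of_rePred hA
  refine ⟨{p | ∀ i < p.1.length + 1, ¬ HaltsBy c p.1.length (p.1.take i, p.2)}, ?_, ?_, ?_⟩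
  · refine PrimrecPred.computablePred ?_
    have h : PrimrecRel fun (i : ℕ) (p : List Bool × α) =>
        ¬ HaltsBy c p.1.length (p.1.take i, p.2) := by
      refine PrimrecPred.not (PrimrecPred.haltsBy ?_ (Primrec.const c) ?_)
      · exact Primrec.list_length.comp (Primrec.fst.comp Primrec.snd)
      · exact Primrec.pair (Primrec.list_take.comp Primrec.fst (Primrec.fst.comp Primrec.snd))
          (Primrec.snd.comp Primrec.snd)
    exact primrecPred_forall_lt (Primrec.succ.comp (Primrec.list_length.comp Primrec.fst)) h
  · intro σ τ a h i hi hs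
    simp only at hi hs
    refine h i (by simp; omega) ?_
    rw [List.take_append_of_le_length (by omega)]
    exact hs.mono (by simp)
  · intro X a
    constructor
    · intro h n hn
      obtain ⟨s, hs⟩ := (hc _).1 hn
      refine h (max n s) n (by simp) ?_
      simp only [take_initSeg, length_initSeg]
      rw [min_eq_left (le_max_left _ _)]
      exact hs.mono (le_max_right _ _)
    · intro h n i hi hs
      simp only [take_initSeg] at hs
      exact h _ ((hc _).2 ⟨_, hs⟩)

end Strings

/-! ### The coin measure of cones and Kraft's inequality. -/

section Measure

instance : IsProbabilityMeasure coinMeasure := by unfold coinMeasure; infer_instance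

theorem initSeg_eq_iff {X : Cantor} {σ : List Bool} :
    initSeg X σ.length = σ ↔ ∀ i < σ.length, X i = σ.getD i false := by
  constructor
  · intro h i hi
    have : (initSeg X σ.length)[i]? = σ[i]? := by rw [h]
    simp [initSeg, hi] at this
    simp [hi, this]
  · intro h
    refine List.ext_getElem (by simp) fun i h₁ h₂ => ?_
    simp [initSeg, h i h₂, h₂]

theorem cone_eq_pi (σ : List Bool) :
    cone σ = Set.pi (Finset.range σ.length : Set ℕ) fun i => {σ.getD i false} := by
  ext X
  simp only [mem_cone_iff, initSeg_eq_iff, Set.mem_pi, Finset.coe_range, Set.mem_Iio,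
    Set.mem_singleton_iff]

theorem measurableSet_cone (σ : List Bool) : MeasurableSet (cone σ) := by
  rw [cone_eq_pi]
  exact MeasurableSet.pi (Set.to_countable _) fun _ _ => measurableSet_singleton _

theorem coinMeasure_cone (σ : List Bool) : coinMeasure (cone σ) = (2 : ℝ≥0∞)⁻¹ ^ σ.length := by
  rw [cone_eq_pi, coinMeasure, Measure.infinitePi_pi _ (fun _ _ => measurableSet_singleton _)]
  simp

theorem disjoint_cone {σ τ : List Bool} (h₁ : ¬ σ <+: τ) (h₂ : ¬ τ <+: σ) :
    Disjoint (cone σ) (cone τ) := by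
  rw [Set.disjoint_left]
  intro X hσ hτ
  rw [mem_cone_iff] at hσ hτ
  rcases le_total σ.length τ.length with h | h
  · refine h₁ ?_
    rw [← hσ, ← hτ, ← min_eq_left h, ← take_initSeg]
    simpa using List.take_prefix _ _
  · refine h₂ ?_
    rw [← hσ, ← hτ, ← min_eq_left h, ← take_initSeg]
    simpa using List.take_prefix _ _

/-- Kraft's inequality for prefix-free sets. -/
theorem tsum_prefixFree_le {V : Set (List Bool)}
    (hV : ∀ σ ∈ V, ∀ τ ∈ V, σ <+: τ → σ = τ) :
    ∑' σ : V, (2 : ℝ≥0∞)⁻¹ ^ (σ : List Bool).length ≤ coinMeasure (coneUnion V) := by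
  rw [coneUnion, measure_biUnion (Set.to_countable V) _ fun σ _ => measurableSet_cone σ]
  · simp only [coinMeasure_cone, le_refl]
  · intro σ hσ τ hτ hne
    exact disjoint_cone (fun h => hne (hV σ hσ τ hτ h)) fun h => hne (hV τ hτ σ hσ h).symm

/-- The list of all binary strings of a given length. -/
def strings : ℕ → List (List Bool)
  | 0 => [[]]
  | n + 1 => (strings n).map (List.cons false) ++ (strings n).map (List.cons true)

theorem mem_strings {n : ℕ} {σ : List Bool} : σ ∈ strings n ↔ σ.length = n := by
  induction n generalizing σ with
  | zero => simp [strings]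
  | succ n ih =>
    cases σ with
    | nil => simp [strings]
    | cons b σ => cases b <;> simp [strings, ih]

theorem nodup_strings (n : ℕ) : (strings n).Nodup := by
  induction n with
  | zero => simp [strings]
  | succ n ih =>
    refine List.Nodup.append (ih.map (List.cons_injective)) (ih.map (List.cons_injective)) ?_
    simp [List.disjoint_left]

theorem primrec_strings : Primrec strings := by
  have hc (b : Bool) : Primrec fun l : List (List Bool) => l.map (List.cons b) :=
    Primrec.list_map Primrec.id
      (Primrec.list_cons.comp (Primrec.const b) Primrec.snd).to₂
  refine (Primrec.nat_rec₁ (f := fun _ l => l.map (List.cons false) ++ l.map (List.cons true)) [[]]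
    (Primrec.list_append.comp ((hc false).comp Primrec.snd) ((hc true).comp Primrec.snd)).to₂).of_eq
      fun n => ?_
  induction n with
  | zero => rfl
  | succ n ih => simp only [strings, ← ih]

/-- Cones of distinct strings of length `t` are disjoint and of equal measure, so the measure is a
count. This makes the measure bound at a finite level decidable. -/
theorem coinMeasure_initSeg_mem (p : List Bool → Prop) [DecidablePred p] (t : ℕ) :
    coinMeasure {X | p (initSeg X t)} =
      (((strings t).filter (p ·)).length : ℝ≥0∞) * (2 : ℝ≥0∞)⁻¹ ^ t := by
  have h : {X | p (initSeg X t)} = ⋃ σ ∈ ((strings t).filter (p ·)).toFinset, cone σ := by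
    ext X
    simp only [Set.mem_ofPred_eq, List.mem_toFinset, List.mem_filter, decide_eq_true_eq,
      Set.mem_iUnion, exists_prop, mem_strings, mem_cone_iff]
    constructor
    · exact fun h => ⟨_, ⟨by simp, h⟩, by simp⟩
    · rintro ⟨σ, ⟨rfl, h⟩, hX⟩
      rwa [hX]
  rw [h, measure_biUnion_finset _ fun σ _ => measurableSet_cone σ]
  · rw [Finset.sum_congr rfl (g := fun _ => (2 : ℝ≥0∞)⁻¹ ^ t), Finset.sum_const,
      List.toFinset_card_of_nodup ((nodup_strings t).filter _), nsmul_eq_mul]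
    intro σ hσ
    simp only [List.mem_toFinset, List.mem_filter, mem_strings] at hσ
    rw [coinMeasure_cone, hσ.1]
  · intro σ hσ τ hτ hne
    simp only [Finset.mem_coe, List.mem_toFinset, List.mem_filter, mem_strings] at hσ hτ
    exact disjoint_cone (fun h => hne (h.eq_of_length (by omega)))
      fun h => hne (h.eq_of_length (by omega)).symm

end Measure

/-! ### A universal Martin-Löf test. -/

section MartinLofTests

/-- Within `|τ|` stages, the `n`-th set of strings coded by `c` receives a prefix of `τ`. -/
def Covers (c : Code) (n : ℕ) (τ : List Bool) : Prop :=
  ∃ i < τ.length + 1, HaltsBy c τ.length (n, τ.take i)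

instance (c : Code) (n : ℕ) : DecidablePred (Covers c n) :=
  fun τ => inferInstanceAs (Decidable (∃ i < τ.length + 1, HaltsBy c τ.length (n, τ.take i)))

theorem primrecPred_covers :
    PrimrecPred fun p : List Bool × Code × ℕ => Covers p.2.1 p.2.2 p.1 := by
  refine primrecPred_exists_lt (q := fun i (p : List Bool × Code × ℕ) =>
    HaltsBy p.2.1 p.1.length (p.2.2, p.1.take i))
    (Primrec.succ.comp (Primrec.list_length.comp Primrec.fst)) ?_
  refine PrimrecPred.haltsBy (Primrec.list_length.comp (Primrec.fst.comp Primrec.snd))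
    (Primrec.fst.comp (Primrec.snd.comp Primrec.snd)) ?_
  exact Primrec.pair (Primrec.snd.comp (Primrec.snd.comp Primrec.snd))
    (Primrec.list_take.comp Primrec.fst (Primrec.fst.comp Primrec.snd))

theorem Covers.mono {c : Code} {n : ℕ} {σ τ : List Bool} (h : Covers c n σ) (hστ : σ <+: τ) :
    Covers c n τ := by
  obtain ⟨i, hi, hs⟩ := h
  have hl := hστ.length_le
  refine ⟨i, by omega, ?_⟩
  obtain ⟨ρ, rfl⟩ := hστ
  rw [List.take_append_of_le_length (by omega)]
  exact hs.mono hl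

theorem initSeg_prefix (X : Cantor) {s t : ℕ} (h : s ≤ t) : initSeg X s <+: initSeg X t := by
  rw [← min_eq_left h, ← take_initSeg]
  exact List.take_prefix _ _

theorem mem_coneUnion_iff_covers {W : Set (ℕ × List Bool)} {c : Code}
    (hc : ∀ p, p ∈ W ↔ ∃ s, HaltsBy c s p) (n : ℕ) (X : Cantor) :
    X ∈ coneUnion {σ | (n, σ) ∈ W} ↔ ∃ t, Covers c n (initSeg X t) := by
  simp only [mem_coneUnion_iff, Set.mem_ofPred_eq, hc, Covers, length_initSeg, take_initSeg]
  constructor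
  · rintro ⟨m, s, hs⟩
    refine ⟨max m s, m, by simp, ?_⟩
    rw [min_eq_left (le_max_left _ _)]
    exact hs.mono (le_max_right _ _)
  · rintro ⟨t, i, -, hs⟩
    exact ⟨_, _, hs⟩

/-- The reals covered at level `t` by the `n`-th set coded by `c` have measure at most `2 ^ (-n)`. -/
def IsSmall (c : Code) (n t : ℕ) : Prop :=
  ((strings t).filter (Covers c n ·)).length * 2 ^ n ≤ 2 ^ t

theorem isSmall_iff {c : Code} {n t : ℕ} :
    IsSmall c n t ↔ coinMeasure {X | Covers c n (initSeg X t)} ≤ (2 : ℝ≥0∞)⁻¹ ^ n := by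
  rw [coinMeasure_initSeg_mem, IsSmall, ← ENNReal.inv_pow, ← ENNReal.inv_pow, ← div_eq_mul_inv,
    ENNReal.div_le_iff (by simp) (by simp), mul_comm ((2 : ℝ≥0∞) ^ n)⁻¹, ← div_eq_mul_inv,
    ENNReal.le_div_iff_mul_le (by simp) (by simp)]
  norm_cast

theorem primrec_pow : Primrec₂ ((· ^ ·) : ℕ → ℕ → ℕ) :=
  Primrec₂.unpaired'.1 Nat.Primrec.pow

theorem primrecPred_isSmall : PrimrecPred fun p : ℕ × Code × ℕ => IsSmall p.2.1 p.2.2 p.1 := by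
  have h : PrimrecRel fun (τ : List Bool) (p : Code × ℕ) => Covers p.1 p.2 τ := primrecPred_covers
  have hl := Primrec.list_length.comp (h.listFilter.comp
    (primrec_strings.comp (Primrec.fst (α := ℕ) (β := Code × ℕ))) Primrec.snd)
  refine (Primrec.nat_le.comp (Primrec.nat_mul.comp hl
    (primrec_pow.comp (Primrec.const 2) (Primrec.snd.comp Primrec.snd)))
    (primrec_pow.comp (Primrec.const 2) Primrec.fst)).of_eq fun p => Iff.rfl

/-- A universal Martin-Löf test. -/
def universalTest : Set (ℕ × List Bool) :=
  {p | ∃ e, Covers (Denumerable.ofNat Code e) (p.1 + e + 1) p.2 ∧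
    IsSmall (Denumerable.ofNat Code e) (p.1 + e + 1) p.2.length}

theorem rePred_universalTest : REPred fun p => p ∈ universalTest := by
  have hn : Primrec fun p : (ℕ × List Bool) × ℕ => p.1.1 + p.2 + 1 :=
    Primrec.succ.comp (Primrec.nat_add.comp (Primrec.fst.comp Primrec.fst) Primrec.snd)
  have he : Primrec fun p : (ℕ × List Bool) × ℕ => Denumerable.ofNat Code p.2 :=
    (Primrec.ofNat Code).comp Primrec.snd
  have hτ : Primrec fun p : (ℕ × List Bool) × ℕ => p.1.2 := Primrec.snd.comp Primrec.fst
  exact rePred_exists ((primrecPred_covers.comp (Primrec.pair hτ (Primrec.pair he hn))).and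
    (primrecPred_isSmall.comp
      (Primrec.pair (Primrec.list_length.comp hτ) (Primrec.pair he hn))))

/-- Levels that are not small contribute nothing, and the small ones increase with `t`. The family
is therefore directed, and the measure of its union is a supremum of values within the bound, for
any code whatsoever. -/
theorem coinMeasure_iUnion_small_le (c : Code) (n : ℕ) :
    coinMeasure (⋃ t, {X | Covers c n (initSeg X t) ∧ IsSmall c n t}) ≤ (2 : ℝ≥0∞)⁻¹ ^ n := by
  have hmono {s t : ℕ} (hst : s ≤ t) (ht : IsSmall c n t) :
      {X | Covers c n (initSeg X s) ∧ IsSmall c n s} ⊆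
        {X | Covers c n (initSeg X t) ∧ IsSmall c n t} :=
    fun X hX => ⟨hX.1.mono (initSeg_prefix X hst), ht⟩
  have hempty {t : ℕ} (ht : ¬ IsSmall c n t) (A : Set Cantor) :
      {X | Covers c n (initSeg X t) ∧ IsSmall c n t} ⊆ A := fun X hX => absurd hX.2 ht
  have hdir : Directed (· ⊆ ·) fun t => {X | Covers c n (initSeg X t) ∧ IsSmall c n t} := by
    intro s t
    by_cases hs : IsSmall c n s
    · by_cases ht : IsSmall c n t
      · rcases le_total s t with h | h
        · exact ⟨t, hmono h ht, subset_rfl⟩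
        · exact ⟨s, subset_rfl, hmono h hs⟩
      · exact ⟨s, subset_rfl, hempty ht _⟩
    · exact ⟨t, hempty hs _, subset_rfl⟩
  rw [hdir.measure_iUnion]
  refine iSup_le fun t => ?_
  by_cases ht : IsSmall c n t
  · exact (measure_mono fun X hX => hX.1).trans (isSmall_iff.1 ht)
  · exact (measure_mono (hempty ht ∅)).trans (by simp)

theorem isMartinLofTest_universalTest : IsMartinLofTest universalTest := by
  refine ⟨rePred_universalTest, fun n => ?_⟩
  have hsub : coneUnion {σ | (n, σ) ∈ universalTest} ⊆
      ⋃ e : ℕ, ⋃ t, {X | Covers (Denumerable.ofNat Code e) (n + e + 1) (initSeg X t) ∧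
        IsSmall (Denumerable.ofNat Code e) (n + e + 1) t} := by
    intro X hX
    obtain ⟨t, e, hc, hs⟩ := mem_coneUnion_iff.1 hX
    simp only [length_initSeg] at hs
    exact Set.mem_iUnion.2 ⟨e, Set.mem_iUnion.2 ⟨t, hc, hs⟩⟩
  -- The shift by `e + 1` makes the contributions of all codes a geometric series with sum `2⁻¹ ^
  -- n`.
  calc coinMeasure (coneUnion {σ | (n, σ) ∈ universalTest})
      ≤ ∑' e : ℕ, (2 : ℝ≥0∞)⁻¹ ^ (n + e + 1) :=
        (measure_mono hsub).trans ((measure_iUnion_le _).trans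
          (ENNReal.tsum_le_tsum fun e => coinMeasure_iUnion_small_le _ _))
    _ = (2 : ℝ≥0∞)⁻¹ ^ n * ∑' e : ℕ, (2 : ℝ≥0∞)⁻¹ ^ (e + 1) := by
        rw [← ENNReal.tsum_mul_left]
        exact tsum_congr fun e => by rw [add_assoc, pow_add]
    _ = (2 : ℝ≥0∞)⁻¹ ^ n := by 
        rw [ENNReal.tsum_geometric_add_one]
        norm_num [ENNReal.one_sub_inv_two, ENNReal.inv_mul_cancel]

theorem mem_MLR_iff_universalTest {X : Cantor} :
    X ∈ MLR ↔ ∃ n, X ∉ coneUnion {σ | (n, σ) ∈ universalTest} := by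
  refine ⟨fun h => h _ isMartinLofTest_universalTest, ?_⟩
  rintro ⟨n, hn⟩ W ⟨hre, hμ⟩
  obtain ⟨c, hc⟩ := exists_code_of_rePred hre
  -- This is the row of `W` that is copied into row `n` of the universal test; since `W` is a test,
  -- the smallness condition never cuts it off.
  refine ⟨n + encode c + 1, fun hX => hn ?_⟩
  have hsmall (t : ℕ) : IsSmall c (n + encode c + 1) t := by
    refine isSmall_iff.2 ((measure_mono fun Y hY => ?_).trans (hμ _))
    exact (mem_coneUnion_iff_covers hc _ _).2 ⟨t, hY⟩
  obtain ⟨t, ht⟩ := (mem_coneUnion_iff_covers hc _ _).1 hX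
  refine mem_coneUnion_iff.2 ⟨t, encode c, ?_⟩
  simp only [Denumerable.ofNat_encode]
  exact ⟨ht, hsmall _⟩

end MartinLofTests

/-! ### The Kraft–Chaitin construction of prefix-free machines. -/

section KraftChaitin

/-- The number with binary expansion `ρ`. -/
def binaryValue (ρ : List Bool) : ℕ := ρ.foldl (fun a b => 2 * a + b.toNat) 0

theorem binaryValue_append_singleton (ρ : List Bool) (b : Bool) :
    binaryValue (ρ ++ [b]) = 2 * binaryValue ρ + b.toNat := by
  simp [binaryValue]

theorem primrec_binaryValue : Primrec binaryValue := by
  have hb : Primrec Bool.toNat := Primrec.dom_finite _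
  exact Primrec.list_foldl Primrec.id (Primrec.const 0) (Primrec.nat_add.comp
    (Primrec.nat_mul.comp (Primrec.const 2) (Primrec.fst.comp Primrec.snd))
    (hb.comp (Primrec.snd.comp Primrec.snd))).to₂

theorem exists_binaryValue_eq {L k : ℕ} (hk : k < 2 ^ L) :
    ∃ ρ : List Bool, ρ.length = L ∧ binaryValue ρ = k := by
  induction L generalizing k with
  | zero => exact ⟨[], rfl, by simp at hk; simp [binaryValue, hk]⟩
  | succ L ih =>
    obtain ⟨ρ, rfl, hρ⟩ := ih (k := k / 2) (by rw [pow_succ] at hk; omega)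
    refine ⟨ρ ++ [decide (k % 2 = 1)], by simp, ?_⟩
    rw [binaryValue_append_singleton, hρ]
    rcases Nat.mod_two_eq_zero_or_one k with h | h <;> simp [h] <;> omega

/-- The left endpoint of the dyadic interval described by a string. -/
def leftEndpoint (ρ : List Bool) : ℚ := binaryValue ρ / 2 ^ ρ.length

/-- Each appended bit selects one half of the current dyadic interval, so the intervals are nested.
-/
theorem leftEndpoint_append (ρ τ : List Bool) :
    leftEndpoint ρ ≤ leftEndpoint (ρ ++ τ) ∧
      leftEndpoint (ρ ++ τ) + 1 / 2 ^ (ρ ++ τ).length ≤ leftEndpoint ρ + 1 / 2 ^ ρ.length := by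
  induction τ using List.reverseRecOn with
  | nil => simp
  | append_singleton τ b ih =>
    have h : leftEndpoint (ρ ++ (τ ++ [b])) =
        leftEndpoint (ρ ++ τ) + b.toNat * (1 / 2 ^ (ρ ++ τ).length / 2) := by
      rw [← List.append_assoc]
      simp only [leftEndpoint, binaryValue_append_singleton, List.length_append,
        List.length_singleton]
      push_cast
      field_simp
      ring
    have h' : (1 : ℚ) / 2 ^ (ρ ++ (τ ++ [b])).length = 1 / 2 ^ (ρ ++ τ).length / 2 := by
      rw [← List.append_assoc, List.length_append (as := ρ ++ τ), List.length_singleton, pow_succ]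
      field_simp
    have hpos : (0 : ℚ) < 1 / 2 ^ (ρ ++ τ).length := by positivity
    rw [h, h']
    have hb : (0 : ℚ) ≤ b.toNat ∧ (b.toNat : ℚ) ≤ 1 := by cases b <;> simp
    constructor <;> nlinarith

/-- A request for a description of length `p.1` of the string `p.2` uses up measure
`2 ^ (-p.1)`. -/
def requestWeight (o : Option (ℕ × List Bool)) : ℚ := o.elim 0 fun p => 1 / 2 ^ p.1

theorem requestWeight_nonneg (o : Option (ℕ × List Bool)) : 0 ≤ requestWeight o := by
  cases o
  · simp [requestWeight]
  · simp only [requestWeight, Option.elim]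
    positivity

/-- Adding the weight of a request to the dyadic rational `r.1 / 2 ^ r.2`. -/
def addRequest (r : ℕ × ℕ) (o : Option (ℕ × List Bool)) : ℕ × ℕ :=
  o.elim r fun p => (r.1 * 2 ^ p.1 + 2 ^ r.2, r.2 + p.1)

/-- The total weight of the first `i` requests as a dyadic rational. -/
def usedWeight (f : ℕ → Option (ℕ × List Bool)) (i : ℕ) : ℕ × ℕ :=
  Nat.rec (0, 0) (fun j r => addRequest r (f j)) i

theorem usedWeight_eq_sum (f : ℕ → Option (ℕ × List Bool)) (i : ℕ) :
    ((usedWeight f i).1 : ℚ) / 2 ^ (usedWeight f i).2 =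
      ∑ j ∈ Finset.range i, requestWeight (f j) := by
  induction i with
  | zero => simp [usedWeight]
  | succ i ih =>
    rw [Finset.sum_range_succ, ← ih]
    have h : usedWeight f (i + 1) = addRequest (usedWeight f i) (f i) := rfl
    rw [h]
    cases f i with
    | none => simp [addRequest, requestWeight]
    | some p =>
      simp only [addRequest, requestWeight, Option.elim]
      push_cast
      rw [pow_add]
      field_simp

theorem primrec_addRequest : Primrec₂ addRequest := by
  have hr : Primrec fun q : ((ℕ × ℕ) × Option (ℕ × List Bool)) × (ℕ × List Bool) => q.1.1 :=
    Primrec.fst.comp Primrec.fst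
  have hp : Primrec fun q : ((ℕ × ℕ) × Option (ℕ × List Bool)) × (ℕ × List Bool) => q.2.1 :=
    Primrec.fst.comp Primrec.snd
  refine (Primrec.option_casesOn Primrec.snd Primrec.fst (Primrec.pair
    (Primrec.nat_add.comp (Primrec.nat_mul.comp (Primrec.fst.comp hr)
      (primrec_pow.comp (Primrec.const 2) hp))
      (primrec_pow.comp (Primrec.const 2) (Primrec.snd.comp hr)))
    (Primrec.nat_add.comp (Primrec.snd.comp hr) hp)).to₂).of_eq fun q => ?_
  rcases q with ⟨r, _ | p⟩ <;> rfl

theorem computable_usedWeight {f : ℕ → Option (ℕ × List Bool)} (hf : Computable f) :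
    Computable (usedWeight f) :=
  Computable.nat_rec Computable.id (Computable.const (0, 0))
    (primrec_addRequest.to_comp.comp (Computable.snd.comp Computable.snd)
      (hf.comp (Computable.fst.comp Computable.snd))).to₂

/-- The dyadic interval described by `ρ` has length `2 ^ (-l - 1)` and lies in the interval of
length `2 ^ (-l)` to the right of `r.1 / 2 ^ r.2`. -/
def Fits (r : ℕ × ℕ) (l : ℕ) (ρ : List Bool) : Prop :=
  ρ.length = l + 1 ∧ r.1 * 2 ^ (l + 1) ≤ binaryValue ρ * 2 ^ r.2 ∧
    binaryValue ρ * 2 ^ r.2 ≤ r.1 * 2 ^ (l + 1) + 2 ^ r.2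

instance (r : ℕ × ℕ) (l : ℕ) (ρ : List Bool) : Decidable (Fits r l ρ) :=
  inferInstanceAs (Decidable (_ ∧ _ ∧ _))

/-- Clearing denominators keeps `Fits` primitive recursive; the interval arguments use this rational
form. -/
theorem fits_iff {r : ℕ × ℕ} {l : ℕ} {ρ : List Bool} :
    Fits r l ρ ↔ ρ.length = l + 1 ∧ (r.1 / 2 ^ r.2 : ℚ) ≤ leftEndpoint ρ ∧
      leftEndpoint ρ + 1 / 2 ^ ρ.length ≤ r.1 / 2 ^ r.2 + 1 / 2 ^ l := by
  refine and_congr_right fun hl => and_congr ?_ ?_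
  · rw [leftEndpoint, hl, div_le_div_iff₀ (by positivity) (by positivity)]
    norm_cast
  · have h : (r.1 / 2 ^ r.2 + 1 / 2 ^ l : ℚ) =
        (r.1 * 2 ^ (l + 1) + 2 ^ r.2) / 2 ^ r.2 / 2 ^ (l + 1) + 1 / 2 ^ (l + 1) := by
      field_simp
      ring
    rw [leftEndpoint, hl, h, add_le_add_iff_right, div_le_div_iff_of_pos_right (by positivity),
      le_div_iff₀ (by positivity)]
    norm_cast

theorem primrecPred_fits :
    PrimrecPred fun q : (ℕ × ℕ) × ℕ × List Bool => Fits q.1 q.2.1 q.2.2 := by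
  have hr : Primrec fun q : (ℕ × ℕ) × ℕ × List Bool => q.1 := Primrec.fst
  have hl : Primrec fun q : (ℕ × ℕ) × ℕ × List Bool => q.2.1 + 1 :=
    Primrec.succ.comp (Primrec.fst.comp Primrec.snd)
  have hρ : Primrec fun q : (ℕ × ℕ) × ℕ × List Bool => q.2.2 := Primrec.snd.comp Primrec.snd
  have h₁ := Primrec.nat_mul.comp (Primrec.fst.comp hr) (primrec_pow.comp (Primrec.const 2) hl)
  have h₂ := primrec_pow.comp (Primrec.const 2) (Primrec.snd.comp hr)
  have h₃ := Primrec.nat_mul.comp (primrec_binaryValue.comp hρ) h₂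
  exact (Primrec.eq.comp (Primrec.list_length.comp hρ) hl).and
    ((Primrec.nat_le.comp h₁ h₃).and (Primrec.nat_le.comp h₃ (Primrec.nat_add.comp h₁ h₂)))

/-- Round the left endpoint up to the grid of mesh `2 ^ (-l - 1)`: the interval is two meshes long,
so a full grid cell remains. The extra bit pays for placing requests consecutively without
alignment. -/
theorem exists_fits {r : ℕ × ℕ} {l : ℕ} (h : (r.1 / 2 ^ r.2 + 1 / 2 ^ l : ℚ) ≤ 1) :
    ∃ ρ, Fits r l ρ := by
  set s : ℚ := r.1 / 2 ^ r.2 with hs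
  have hs₀ : 0 ≤ s := by positivity
  have h₁ : s * 2 ^ (l + 1) ≤ ⌈s * 2 ^ (l + 1)⌉₊ := Nat.le_ceil _
  have h₂ : (⌈s * 2 ^ (l + 1)⌉₊ : ℚ) < s * 2 ^ (l + 1) + 1 := Nat.ceil_lt_add_one (by positivity)
  have h₃ : (s + 1 / 2 ^ l) * 2 ^ (l + 1) = s * 2 ^ (l + 1) + 2 := by
    field_simp
    ring
  have h₄ : (s + 1 / 2 ^ l) * 2 ^ (l + 1) ≤ 1 * 2 ^ (l + 1) :=
    mul_le_mul_of_nonneg_right h (by positivity)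
  have hlt : ⌈s * 2 ^ (l + 1)⌉₊ < 2 ^ (l + 1) := by
    have : (⌈s * 2 ^ (l + 1)⌉₊ : ℚ) < 2 ^ (l + 1) := by linarith
    exact_mod_cast this
  obtain ⟨ρ, hl, hv⟩ := exists_binaryValue_eq hlt
  refine ⟨ρ, fits_iff.2 ⟨hl, ?_, ?_⟩⟩
  · rw [leftEndpoint, hl, hv, le_div_iff₀ (by positivity)]
    exact h₁
  · rw [leftEndpoint, hl, hv, ← add_div, div_le_iff₀ (by positivity), ← hs, h₃]
    linarith

/-- The machine that answers the requests in `f`. -/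
def requestMachine (f : ℕ → Option (ℕ × List Bool)) (ρ : List Bool) : Part (List Bool) :=
  Nat.rfindOpt fun i => (f i).bind fun p => if Fits (usedWeight f i) p.1 ρ then some p.2 else none

theorem partrec_requestMachine {f : ℕ → Option (ℕ × List Bool)} (hf : Computable f) :
    Partrec (requestMachine f) := by
  have hg : Primrec fun q : Option (ℕ × List Bool) × (ℕ × ℕ) × List Bool =>
      q.1.bind fun p => if Fits q.2.1 p.1 q.2.2 then some p.2 else none := by
    refine Primrec.option_bind Primrec.fst (Primrec.ite ?_ ?_ (Primrec.const none))
    · exact primrecPred_fits.comp (Primrec.pair (Primrec.fst.comp (Primrec.snd.comp Primrec.fst))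
        (Primrec.pair (Primrec.fst.comp Primrec.snd)
          (Primrec.snd.comp (Primrec.snd.comp Primrec.fst))))
    · exact Primrec.option_some.comp (Primrec.snd.comp Primrec.snd)
  exact Partrec.rfindOpt (hg.to_comp.comp (Computable.pair (hf.comp Computable.snd)
    (Computable.pair ((computable_usedWeight hf).comp Computable.snd) Computable.fst))).to₂

theorem exists_fits_of_mem_requestMachine {f : ℕ → Option (ℕ × List Bool)} {ρ τ : List Bool}
    (h : τ ∈ requestMachine f ρ) :
    ∃ i l, f i = some (l, τ) ∧ Fits (usedWeight f i) l ρ := by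
  obtain ⟨i, hi⟩ := Nat.rfindOpt_spec h
  simp only [Option.mem_def, Option.bind_eq_some_iff, Option.ite_none_right_eq_some] at hi
  obtain ⟨⟨l, τ'⟩, hfi, hfit, h⟩ := hi
  obtain rfl : τ' = τ := by simpa using h
  exact ⟨i, l, hfi, hfit⟩

/-- Request `i` owns the interval that starts at the total weight of the earlier requests and has
its own weight as length. For different requests these overlap in at most an endpoint, whereas the
interval of `ρ'` has positive length and would lie in both. -/
theorem fits_index_unique {f : ℕ → Option (ℕ × List Bool)} {ρ ρ' τ τ' : List Bool} {i i' l l' : ℕ}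
    (hi : f i = some (l, τ)) (hi' : f i' = some (l', τ')) (h : Fits (usedWeight f i) l ρ)
    (h' : Fits (usedWeight f i') l' ρ') (hρ : ρ <+: ρ') : i = i' := by
  have key {j k m : ℕ} {σ : List Bool} (hj : f j = some (m, σ)) (hjk : j < k) :
      ∑ n ∈ Finset.range j, requestWeight (f n) + 1 / 2 ^ m ≤
        ∑ n ∈ Finset.range k, requestWeight (f n) := by
    have hw : requestWeight (f j) = 1 / 2 ^ m := by rw [hj]; rfl
    rw [← hw, ← Finset.sum_range_succ]
    exact Finset.sum_le_sum_of_subset_of_nonneg (by simpa using hjk)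
      fun n _ _ => requestWeight_nonneg _
  obtain ⟨ξ, rfl⟩ := hρ
  obtain ⟨h₁, h₂⟩ := leftEndpoint_append ρ ξ
  obtain ⟨-, h₃, h₄⟩ := fits_iff.1 h
  obtain ⟨-, h₅, h₆⟩ := fits_iff.1 h'
  rw [usedWeight_eq_sum] at h₃ h₄ h₅ h₆
  have hpos : (0 : ℚ) < 1 / 2 ^ (ρ ++ ξ).length := by positivity
  rcases lt_trichotomy i i' with hlt | heq | hlt
  · have := key hi hlt
    linarith
  · exact heq
  · have := key hi' hlt
    linarith

theorem isPrefixMachine_requestMachine {f : ℕ → Option (ℕ × List Bool)} (hf : Computable f) :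
    IsPrefixMachine (requestMachine f) := by
  refine ⟨partrec_requestMachine hf, fun ρ ρ' hρ hρ' hpre => ?_⟩
  obtain ⟨τ, hτ⟩ := Part.dom_iff_mem.1 hρ
  obtain ⟨τ', hτ'⟩ := Part.dom_iff_mem.1 hρ'
  obtain ⟨i, l, hi, hfit⟩ := exists_fits_of_mem_requestMachine hτ
  obtain ⟨i', l', hi', hfit'⟩ := exists_fits_of_mem_requestMachine hτ'
  obtain rfl := fits_index_unique hi hi' hfit hfit' hpre
  obtain ⟨rfl, rfl⟩ : l = l' ∧ τ = τ' := by simpa using hi.symm.trans hi'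
  exact hpre.eq_of_length (hfit.1.trans hfit'.1.symm)

/-- The Kraft–Chaitin theorem, with descriptions longer by one bit than requested. -/
theorem exists_mem_requestMachine {f : ℕ → Option (ℕ × List Bool)}
    (hsum : ∀ n, ∑ j ∈ Finset.range n, requestWeight (f j) ≤ 1) {i l : ℕ} {τ : List Bool}
    (hi : f i = some (l, τ)) : ∃ ρ : List Bool, ρ.length = l + 1 ∧ τ ∈ requestMachine f ρ := by
  have hw : requestWeight (f i) = 1 / 2 ^ l := by rw [hi]; rfl
  obtain ⟨ρ, hρ⟩ : ∃ ρ, Fits (usedWeight f i) l ρ := by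
    refine exists_fits ?_
    rw [usedWeight_eq_sum, ← hw, ← Finset.sum_range_succ]
    exact hsum _
  refine ⟨ρ, hρ.1, ?_⟩
  have hdom : (requestMachine f ρ).Dom := Nat.rfindOpt_dom.2 ⟨i, τ, by simp [hi, hρ]⟩
  obtain ⟨τ', hτ'⟩ := Part.dom_iff_mem.1 hdom
  -- The search could have stopped at another request that `ρ` fits; uniqueness of the index
  -- excludes this.
  obtain ⟨i', l', hi', hfit'⟩ := exists_fits_of_mem_requestMachine hτ'
  obtain rfl := fits_index_unique hi hi' hρ hfit' List.prefix_rfl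
  obtain ⟨-, rfl⟩ : l = l' ∧ τ = τ' := by simpa using hi.symm.trans hi'
  exact hτ'

end KraftChaitin

/-! ### Incompressible reals are Martin-Löf random. -/

section Schnorr

/-- The minimal strings covered by the `n`-th set coded by `c`. -/
def minimalCovers (c : Code) (n : ℕ) : Set (List Bool) :=
  {τ | Covers c n τ ∧ ∀ i < τ.length, ¬ Covers c n (τ.take i)}

theorem primrecPred_minimalCovers (c : Code) :
    PrimrecPred fun p : ℕ × List Bool => p.2 ∈ minimalCovers c p.1 := by
  refine (primrecPred_covers.comp (Primrec.pair Primrec.snd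
    (Primrec.pair (Primrec.const c) Primrec.fst))).and
    (primrecPred_forall_lt (q := fun i (p : ℕ × List Bool) => ¬ Covers c p.1 (p.2.take i))
      (Primrec.list_length.comp Primrec.snd) (PrimrecPred.not ?_))
  exact primrecPred_covers.comp (Primrec.pair
    (Primrec.list_take.comp Primrec.fst (Primrec.snd.comp Primrec.snd))
    (Primrec.pair (Primrec.const c) (Primrec.fst.comp Primrec.snd)))

theorem minimalCovers_prefixFree {c : Code} {n : ℕ} :
    ∀ σ ∈ minimalCovers c n, ∀ τ ∈ minimalCovers c n, σ <+: τ → σ = τ := by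
  intro σ hσ τ hτ h
  by_contra hne
  have hlt : σ.length < τ.length :=
    lt_of_le_of_ne h.length_le fun heq => hne (h.eq_of_length heq)
  exact hτ.2 _ hlt ((List.prefix_iff_eq_take.1 h) ▸ hσ.1)

theorem exists_initSeg_mem_minimalCovers {c : Code} {n : ℕ} {X : Cantor}
    (h : ∃ t, Covers c n (initSeg X t)) : ∃ t, initSeg X t ∈ minimalCovers c n := by
  classical
  refine ⟨Nat.find h, Nat.find_spec h, fun i hi => ?_⟩
  rw [length_initSeg] at hi
  rw [take_initSeg, min_eq_left hi.le]
  exact Nat.find_min h hi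

variable {W : Set (ℕ × List Bool)} {c : Code}

theorem coneUnion_minimalCovers_subset (hc : ∀ p, p ∈ W ↔ ∃ s, HaltsBy c s p) (n : ℕ) :
    coneUnion (minimalCovers c n) ⊆ coneUnion {σ | (n, σ) ∈ W} := by
  intro X hX
  obtain ⟨t, ht⟩ := mem_coneUnion_iff.1 hX
  exact (mem_coneUnion_iff_covers hc n X).2 ⟨t, ht.1⟩

theorem tsum_minimalCovers_le (hW : IsMartinLofTest W) (hc : ∀ p, p ∈ W ↔ ∃ s, HaltsBy c s p)
    (n : ℕ) : ∑' τ : minimalCovers c n, (2 : ℝ≥0∞)⁻¹ ^ (τ : List Bool).length ≤ 2⁻¹ ^ n :=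
  (tsum_prefixFree_le minimalCovers_prefixFree).trans
    ((measure_mono (coneUnion_minimalCovers_subset hc n)).trans (hW.2 n))

/-- One string cannot weigh more than its whole row. This ensures that the truncated subtraction in
the requested length is a genuine saving. -/
theorem le_length_of_mem_minimalCovers (hW : IsMartinLofTest W)
    (hc : ∀ p, p ∈ W ↔ ∃ s, HaltsBy c s p) {n : ℕ} {τ : List Bool}
    (hτ : τ ∈ minimalCovers c n) : n ≤ τ.length := by
  have h : (2 : ℝ≥0∞)⁻¹ ^ τ.length ≤ 2⁻¹ ^ n :=
    (ENNReal.le_tsum (f := fun σ : minimalCovers c n => (2 : ℝ≥0∞)⁻¹ ^ (σ : List Bool).length)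
      ⟨τ, hτ⟩).trans (tsum_minimalCovers_le hW hc n)
  rw [← ENNReal.inv_pow, ← ENNReal.inv_pow, ENNReal.inv_le_inv] at h
  exact (Nat.pow_le_pow_iff_right (by norm_num : 1 < 2)).1 (by exact_mod_cast h)

open Classical in
/-- The requests that compress the minimal strings covered by row `2 * n + 1` of the test coded
by `c` by `n` bits. -/
noncomputable def testRequests (c : Code) (i : ℕ) : Option (ℕ × List Bool) :=
  (decode i : Option (ℕ × List Bool)).bind fun p =>
    -- Requiring `encode p = i` issues each request only once, so the total weight is a sum over
    -- pairs.
    if encode p = i ∧ p.2 ∈ minimalCovers c (2 * p.1 + 1) then some (p.2.length - p.1, p.2)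
    else none

theorem computable_testRequests (c : Code) : Computable (testRequests c) := by
  classical
  refine Primrec.to_comp (Primrec.option_bind Primrec.decode
    (Primrec.ite (PrimrecPred.and ?_ ?_) ?_ (Primrec.const none)))
  · exact Primrec.eq.comp (Primrec.encode.comp Primrec.snd) Primrec.fst
  · exact (primrecPred_minimalCovers c).comp (Primrec.pair
      (Primrec.succ.comp (Primrec.nat_mul.comp (Primrec.const 2)
        (Primrec.fst.comp Primrec.snd))) (Primrec.snd.comp Primrec.snd))
  · exact Primrec.option_some.comp (Primrec.pair (Primrec.nat_sub.comp
      (Primrec.list_length.comp (Primrec.snd.comp Primrec.snd)) (Primrec.fst.comp Primrec.snd))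
      (Primrec.snd.comp Primrec.snd))

theorem testRequests_encode {n : ℕ} {τ : List Bool} (hτ : τ ∈ minimalCovers c (2 * n + 1)) :
    testRequests c (encode (n, τ)) = some (τ.length - n, τ) := by
  simp only [testRequests, encodek, Option.bind_some, hτ, and_self, if_true]

theorem sum_requestWeight_le_one {f : ℕ → Option (ℕ × List Bool)}
    (hf : ∑' i, (f i).elim 0 (fun p => (2 : ℝ≥0∞)⁻¹ ^ p.1) ≤ 1) (n : ℕ) :
    ∑ j ∈ Finset.range n, requestWeight (f j) ≤ 1 := by
  have hw (o : Option (ℕ × List Bool)) :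
      ENNReal.ofReal (requestWeight o : ℝ) = o.elim 0 fun p => (2 : ℝ≥0∞)⁻¹ ^ p.1 := by
    cases o with
    | none => simp [requestWeight]
    | some p =>
      simp only [requestWeight, Option.elim]
      push_cast
      rw [one_div, ← inv_pow, ENNReal.ofReal_pow (by norm_num),
        ENNReal.ofReal_inv_of_pos (by norm_num)]
      simp
  have h := (ENNReal.sum_le_tsum (Finset.range n)).trans hf
  simp only [← hw] at h
  rw [← ENNReal.ofReal_sum_of_nonneg fun i _ => by exact_mod_cast requestWeight_nonneg (f i),
    ENNReal.ofReal_le_one] at h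
  exact_mod_cast h

/-- Saving `n` bits multiplies weights by at most `2 ^ n`, and row `2 * n + 1` weighs at most `2⁻¹ ^
(2 * n + 1)`. The `n`-th group thus costs at most `2⁻¹ ^ (n + 1)`, and these bounds sum to one. -/
theorem tsum_testRequests_le (hW : IsMartinLofTest W) (hc : ∀ p, p ∈ W ↔ ∃ s, HaltsBy c s p) :
    ∑' i, (testRequests c i).elim 0 (fun p => (2 : ℝ≥0∞)⁻¹ ^ p.1) ≤ 1 := by
  classical
  have hsupp : Function.support
      (fun i => (testRequests c i).elim 0 (fun p => (2 : ℝ≥0∞)⁻¹ ^ p.1)) ⊆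
      Set.range (encode : ℕ × List Bool → ℕ) := by
    intro i hi
    cases h : testRequests c i with
    | none => simp [h] at hi
    | some q =>
      simp only [testRequests, Option.bind_eq_some_iff, Option.ite_none_right_eq_some] at h
      obtain ⟨p, -, h, -⟩ := h
      exact ⟨p, h.1⟩
  -- Only an inequality, because the subtraction truncates when `k < n`.
  have hpow (n k : ℕ) : (2 : ℝ≥0∞)⁻¹ ^ (k - n) ≤ 2 ^ n * 2⁻¹ ^ k := by
    have h : (2 : ℝ≥0∞) ^ n * 2⁻¹ ^ n = 1 := by
      rw [← mul_pow, ENNReal.mul_inv_cancel (by simp) (by simp), one_pow]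
    calc (2 : ℝ≥0∞)⁻¹ ^ (k - n) = 2 ^ n * 2⁻¹ ^ (n + (k - n)) := by
          rw [pow_add, ← mul_assoc, h, one_mul]
      _ ≤ 2 ^ n * 2⁻¹ ^ k :=
          mul_le_mul_right (pow_le_pow_right_of_le_one' (by simp) (by omega)) _
  have hrow (n : ℕ) : ∑' τ : List Bool,
      (testRequests c (encode (n, τ))).elim 0 (fun p => (2 : ℝ≥0∞)⁻¹ ^ p.1) ≤ 2⁻¹ ^ (n + 1) := by
    calc _ ≤ ∑' τ : List Bool, (minimalCovers c (2 * n + 1)).indicator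
            (fun τ => 2 ^ n * (2 : ℝ≥0∞)⁻¹ ^ τ.length) τ := by
          refine ENNReal.tsum_le_tsum fun τ => ?_
          by_cases hτ : τ ∈ minimalCovers c (2 * n + 1)
          · rw [testRequests_encode hτ, Set.indicator_of_mem hτ]
            exact hpow _ _
          · simp [testRequests, hτ]
      _ = 2 ^ n * ∑' τ : minimalCovers c (2 * n + 1), (2 : ℝ≥0∞)⁻¹ ^ (τ : List Bool).length := by
          rw [← tsum_subtype, ENNReal.tsum_mul_left]
      _ ≤ 2 ^ n * 2⁻¹ ^ (2 * n + 1) := mul_le_mul_right (tsum_minimalCovers_le hW hc _) _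
      _ = 2⁻¹ ^ (n + 1) := by
          rw [show 2 * n + 1 = n + (n + 1) by ring, pow_add _ n, ← mul_assoc, ← mul_pow,
            ENNReal.mul_inv_cancel (by simp) (by simp), one_pow, one_mul]
  rw [← Function.Injective.tsum_eq (encode_injective (α := ℕ × List Bool)) hsupp,
    ENNReal.tsum_prod (f := fun n τ =>
      (testRequests c (encode (n, τ))).elim 0 (fun p => (2 : ℝ≥0∞)⁻¹ ^ p.1))]
  refine (ENNReal.tsum_le_tsum hrow).trans ?_
  rw [ENNReal.tsum_geometric_add_one]
  norm_num [ENNReal.one_sub_inv_two, ENNReal.inv_mul_cancel]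

theorem le_K_add_iff {U : List Bool →. List Bool} {τ : List Bool} {n c : ℕ} :
    (n : ℕ∞) ≤ K U τ + c ↔ ∀ ρ, τ ∈ U ρ → n ≤ ρ.length + c := by
  rw [← tsub_le_iff_right, K, le_iInf₂_iff]
  refine forall₂_congr fun ρ _ => ?_
  rw [tsub_le_iff_right]
  norm_cast

/-- One half of Schnorr's theorem: incompressible reals are Martin-Löf random. -/
theorem mem_MLR_of_le_K {U : List Bool →. List Bool} (hU : IsOptimalPrefixMachine U) {b : ℕ}
    {X : Cantor} (hX : ∀ n : ℕ, (n : ℕ∞) ≤ K U (initSeg X n) + b) : X ∈ MLR := by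
  intro W hW
  by_contra! hall
  obtain ⟨c, hc⟩ := exists_code_of_rePred hW.1
  obtain ⟨d, hd⟩ := hU.2 _ (isPrefixMachine_requestMachine (computable_testRequests c))
  -- The saving must beat the deficiency `b`, the simulation cost `d` and the extra Kraft–Chaitin
  -- bit, with one more for strictness.
  set n := b + d + 2 with hn
  obtain ⟨t, ht⟩ := exists_initSeg_mem_minimalCovers
    ((mem_coneUnion_iff_covers hc _ _).1 (hall (2 * n + 1)))
  obtain ⟨ρ, hρ, hmem⟩ := exists_mem_requestMachine
    (sum_requestWeight_le_one (tsum_testRequests_le hW hc)) (testRequests_encode ht)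
  obtain ⟨ξ, hξ, hlen⟩ := hd _ _ hmem
  have h₁ := le_K_add_iff.1 (hX t) ξ hξ
  have h₂ := le_length_of_mem_minimalCovers hW hc ht
  rw [length_initSeg] at h₂ hρ
  omega

end Schnorr

/-! ### The two effective enumerations. -/

section Enumerations

theorem rePred_compressible {U : List Bool →. List Bool} (hU : Partrec U) (c : ℕ) :
    REPred fun τ : List Bool => ∃ ρ, τ ∈ U ρ ∧ ρ.length + c < τ.length := by
  obtain ⟨u, hu⟩ := exists_code_of_partrec hU
  have hmem (ρ τ : List Bool) :
      τ ∈ U ρ ↔ ∃ s, Code.evaln s u (encode ρ) = some (encode τ) := by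
    have h : encode τ ∈ Code.eval u (encode ρ) ↔
      ∃ s, Code.evaln s u (encode ρ) = some (encode τ) := Code.evaln_complete
    rw [← h, hu]
    simp
  have hρ : Primrec fun p : List Bool × List Bool × ℕ => p.2.1 := Primrec.fst.comp Primrec.snd
  have hs : Primrec fun p : List Bool × List Bool × ℕ => p.2.2 := Primrec.snd.comp Primrec.snd
  refine (rePred_exists (q := fun (τ : List Bool) (p : List Bool × ℕ) =>
    Code.evaln p.2 u (encode p.1) = some (encode τ) ∧ p.1.length + c < τ.length)
    (PrimrecPred.and ?_ ?_)).of_eq fun τ => ?_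
  · exact Primrec.eq.comp (Code.primrec_evaln.comp (Primrec.pair
      (Primrec.pair hs (Primrec.const u)) (Primrec.encode.comp hρ)))
      (Primrec.option_some.comp (Primrec.encode.comp Primrec.fst))
  · exact Primrec.nat_lt.comp (Primrec.nat_add.comp (Primrec.list_length.comp hρ)
      (Primrec.const c)) (Primrec.list_length.comp Primrec.fst)
  · simp only [hmem, Prod.exists]
    exact exists_congr fun ρ => exists_and_right

theorem effectivelyEnumerable_randomWithConstant {U : List Bool →. List Bool}
    (hU : IsOptimalPrefixMachine U) (c : ℕ) :
    EffectivelyEnumerablePi01 {P | IsPi01Class P ∧ P ⊆ randomWithConstant U c} := by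
  have hA : REPred fun p : List Bool × ℕ =>
      (∃ s, HaltsBy (Denumerable.ofNat Code p.2) s p.1) ∨
        ∃ ρ, p.1 ∈ U ρ ∧ ρ.length + c < p.1.length :=
    rePred_or (rePred_halts ((Primrec.ofNat Code).comp Primrec.snd) Primrec.fst)
      (rePred_comp (rePred_compressible hU.1.1 c) Computable.fst)
  obtain ⟨R, hR, hclosed, hpaths⟩ := exists_prefixClosed_computable hA
  have hsection (e : ℕ) (X : Cantor) : (∀ n, (initSeg X n, e) ∈ R) ↔
      (∀ n, ¬ ∃ s, HaltsBy (Denumerable.ofNat Code e) s (initSeg X n)) ∧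
        X ∈ randomWithConstant U c := by
    -- Schnorr's theorem makes the Martin-Löf clause redundant, leaving a Π⁰₁ condition.
    have hrandom : X ∈ randomWithConstant U c ↔
        ∀ n, ¬ ∃ ρ, initSeg X n ∈ U ρ ∧ ρ.length + c < (initSeg X n).length := by
      simp only [not_exists, not_and, not_lt, length_initSeg, ← le_K_add_iff]
      exact ⟨fun h => h.2, fun h => ⟨mem_MLR_of_le_K hU h, h⟩⟩
    rw [hpaths, hrandom, ← forall_and]
    exact forall_congr' fun n => not_or
  refine ⟨_, ⟨R, hR, rfl⟩, ?_⟩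
  ext P
  constructor
  · rintro ⟨⟨T, hT, -, rfl⟩, hP⟩
    -- The index of a class is a code enumerating the complement of its tree.
    obtain ⟨e, he⟩ := exists_code_of_rePred hT.not.to_re
    refine ⟨encode e, ?_⟩
    ext X
    refine (hsection _ X).trans ?_
    simp only [Denumerable.ofNat_encode, ← he, not_not]
    exact ⟨fun h => h.1, fun h => ⟨h, hP h⟩⟩
  · rintro ⟨e, rfl⟩
    refine ⟨⟨{σ | (σ, e) ∈ R}, ?_, fun σ τ h => hclosed σ τ e h, rfl⟩,
      fun X hX => ((hsection e X).1 hX).2⟩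
    exact computablePred_comp hR (Computable.pair Computable.id (Computable.const e))

theorem effectivelyEnumerable_MLR :
    EffectivelyEnumerableSigma02 {P | IsSigma02Class P ∧ P ⊆ MLR} := by
  have hσ : Primrec fun p : List Bool × ℕ × ℕ => p.1 := Primrec.fst
  have hm : Primrec fun p : List Bool × ℕ × ℕ => p.2.1.unpair :=
    Primrec.unpair.comp (Primrec.fst.comp Primrec.snd)
  have he : Primrec fun p : List Bool × ℕ × ℕ => Denumerable.ofNat Code p.2.2 :=
    (Primrec.ofNat Code).comp (Primrec.snd.comp Primrec.snd)
  have hA : REPred fun p : List Bool × ℕ × ℕ =>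
      (∃ s, HaltsBy (Denumerable.ofNat Code p.2.2) s (p.1, p.2.1.unpair.1)) ∨
        (p.2.1.unpair.2, p.1) ∈ universalTest :=
    rePred_or (rePred_halts he (Primrec.pair hσ (Primrec.fst.comp hm)))
      (rePred_comp rePred_universalTest (Primrec.pair (Primrec.snd.comp hm) hσ).to_comp)
  obtain ⟨R, hR, -, hpaths⟩ := exists_prefixClosed_computable hA
  have hsection (e : ℕ) (X : Cantor) : (∃ m, ∀ n, (initSeg X n, m, e) ∈ R) ↔
      (∃ m : ℕ, ∀ n, ¬ ∃ s, HaltsBy (Denumerable.ofNat Code e) s (initSeg X n, m)) ∧ X ∈ MLR := by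
    simp only [hpaths, mem_MLR_iff_universalTest, mem_coneUnion_iff, Set.mem_ofPred_eq, not_or,
      forall_and, not_exists]
    constructor
    · rintro ⟨m, h₁, h₂⟩
      exact ⟨⟨_, h₁⟩, _, h₂⟩
    · rintro ⟨⟨a, h₁⟩, k, h₂⟩
      -- A single existential witness codes both the Σ⁰₂ witness `a` and the row `k` of the
      -- universal test that `X` avoids.
      exact ⟨Nat.pair a k, by simpa using h₁, by simpa using h₂⟩
  refine ⟨_, ⟨R, hR, rfl⟩, ?_⟩
  ext P
  constructor
  · rintro ⟨⟨T, hT, rfl⟩, hP⟩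
    obtain ⟨e, he⟩ := exists_code_of_rePred hT.not.to_re
    refine ⟨encode e, ?_⟩
    ext X
    refine (hsection _ X).trans ?_
    simp only [Denumerable.ofNat_encode, ← he, not_not]
    exact ⟨fun h => h.1, fun h => ⟨h, hP h⟩⟩
  · rintro ⟨e, rfl⟩
    refine ⟨⟨{p | (p.1, p.2, e) ∈ R}, ?_, rfl⟩, fun X hX => ((hsection e X).1 hX).2⟩
    exact computablePred_comp hR (Computable.pair Computable.fst
      (Computable.pair Computable.snd (Computable.const e)))

end Enumerations

end Numberings

theorem mainTheorem7 :
    (∀ U : List Bool →. List Bool, Numberings.IsOptimalPrefixMachine U → ∀ c : ℕ,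
      Numberings.EffectivelyEnumerablePi01
        {P | Numberings.IsPi01Class P ∧ P ⊆ Numberings.randomWithConstant U c}) ∧
    Numberings.EffectivelyEnumerableSigma02
      {P | Numberings.IsSigma02Class P ∧ P ⊆ Numberings.MLR} :=
  ⟨fun _ hU c => Numberings.effectivelyEnumerable_randomWithConstant hU c,
    Numberings.effectivelyEnumerable_MLR⟩
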